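/- Let $\mathcal H$ be a separable infinite-dimensional complex Hilbert space. A *Schauder basis* of $\mathcal H$ is a sequence $(f_n)_{n\ge1}$ such that every $f\in\mathcal H$ has a unique norm-convergent expansion $f=\sum_n c_nf_n$. A bounded operator $T$ on $\mathcal H$ is a *Schauder operator* if there is an orthonormal basis (ONB) $(e_n)_{n\ge 1}$ such that the columns of the matrix of $T$ with respect to it, i.e. the vectors $Te_n$, form a Schauder basis. The *Schauder spectrum* $\sigma_S(T)$ is the set of all $\lambda\in\mathbb C$ such that $\lambda I-T$ is not a Schauder operator. The *essential spectrum* $\sigma_e(T)$ is the set of all $\lambda\in\mathbb C$ such that $\lambda I-T$ is not Fredholm. Given an ONB $(e_n)$ and infinite sets $A=\{a_1<a_2<\cdots\}$, $B=\{b_1<b_2<\cdots\}$ of natural numbers, the *spread* $S_{A,B}$ is the bounded operator with $S_{A,B}e_{a_k}=e_{b_k}$ for all $k$ and $S_{A,B}e_n=0$ for $n\notin A$. A unitary operator $U$ is a *unitary spread* if there are an ONB and a sequence of spreads $S_{A_n,B_n}$ with respect to it such that $\sum_{n=1}^\infty S_{A_n,B_n}$ converges to $U$ in the strong operator topology. A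 *ring* is a set $\{\lambda\in\mathbb C:|\lambda|\in I\}$ with $I\subseteq(0,\infty)$ a non-degenerate interval (open, closed or half-open), and $R^o_{\lambda_1,\lambda_2}=\{\lambda\in\mathbb C:\lambda_1<|\lambda|<\lambda_2\}$. **Theorem.** Let $A$ be a bounded self-adjoint Schauder operator on $\mathcal H$. (i) If $\sigma(A)\subseteq[\lambda_1,\lambda_2]$, $\lambda_1>0$ and $\lambda_1,\lambda_2\in\sigma_e(A)$, then there exists a unitary spread $U$ such that $\sigma_S(UA)\supseteq R$ for every ring $R\subseteq R^o_{\lambda_1,\lambda_2}$. (ii) If $\lambda_1,\lambda_2\in\sigma_e(A)$ and $0<\lambda_1<\lambda_2$, then there exists a unitary spread $U$ such that $\sigma_S(UA)\supseteq R$ for every ring $R\subseteq R^o_{\lambda_1,\lambda_2}$. (iii) Let $\lambda_1>0$ and $\sigma_e(A)=\{\lambda_1\}$, and suppose that there are sequences $(t_k)_{k\ge1}$ and $(r_k)_{k\ge1}$ in $\sigma(A)$ with $t_k<t_{k+1}$ and $r_k>r_{k+1}$ for all $k$, $t_k\to\lambda_1$, $r_k\to\lambda_1$, $$\sum_{n=1}^\infty\prod_{k=1}^n\Big(\frac{t_k}{\lambda_1}\Big)^2<\infty\quad\text{and}\quad\sum_{n=1}^\infty\prod_{k=1}^n\Big(\frac{\lambda_1}{r_k}\Big)^2<\infty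 .$$ Then there exists a unitary spread $U$ such that $\sigma_S(UA)\supseteq\{\lambda\in\mathbb C:|\lambda|=\lambda_1\}$. -/

import Mathlib

open Filter Topology

namespace SchauderOp

/-- `f` is a Schauder basis of `H`: every `x` has a unique expansion `x = ∑ c n • f n`, where the
series converges in norm (that is, its sequence of partial sums tends to `x`). -/
def IsSchauderBasis {H : Type*} [NormedAddCommGroup H] [InnerProductSpace ℂ H]
    (f : ℕ → H) : Prop :=
  ∀ x : H, ∃! c : ℕ → ℂ,
    Tendsto (fun N : ℕ => ∑ n ∈ Finset.range N, c n • f n) atTop (𝓝 x)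

/-- `T` is a Schauder operator: for some orthonormal basis `e`, the columns of the matrix of `T`
with respect to `e` form a Schauder basis. The `n`-th column is the coordinate sequence of the
vector `T (e n)` with respect to `e`. -/
def IsSchauderOperator {H : Type*} [NormedAddCommGroup H] [InnerProductSpace ℂ H]
    (T : H →L[ℂ] H) : Prop :=
  ∃ e : HilbertBasis ℕ ℂ H, IsSchauderBasis (fun n => T (e n))

/-- The Schauder spectrum `σ_S(T)`: all `μ` such that `μ I - T` has a Schauder matrix with respect
to no orthonormal basis. -/
def schauderSpectrum {H : Type*} [NormedAddCommGroup H] [InnerProductSpace ℂ H]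
    (T : H →L[ℂ] H) : Set ℂ :=
  {μ : ℂ | ¬ IsSchauderOperator (μ • ContinuousLinearMap.id ℂ H - T)}

/-- The essential spectrum `σ_e(T)`: all `μ` such that `μ I - T` is not a Fredholm operator. -/
def essentialSpectrum {H : Type*} [NormedAddCommGroup H] [InnerProductSpace ℂ H]
    (T : H →L[ℂ] H) : Set ℂ :=
  {μ : ℂ | ¬ (μ • ContinuousLinearMap.id ℂ H - T).IsFredholm}

/-- For an infinite set `A = {a₀ < a₁ < ...}` of natural numbers, the isometry from `ℓ²` into `H`
which maps the `k`-th unit vector to `e (a k)`. -/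
noncomputable def selectIsometry {H : Type*} [NormedAddCommGroup H] [InnerProductSpace ℂ H]
    [CompleteSpace H] (e : HilbertBasis ℕ ℂ H) (A : Set ℕ) (hA : A.Infinite) :
    lp (fun _ : ℕ => ℂ) 2 →ₗᵢ[ℂ] H :=
  (e.orthonormal.comp (fun k : ℕ => Nat.nth (fun n => n ∈ A) k)
    (Nat.nth_injective hA)).orthogonalFamily.linearIsometry

/-- The spread from `A = {a₀ < a₁ < ...}` to `B = {b₀ < b₁ < ...}` with respect to the orthonormal
basis `e`: the operator which maps `e (a k)` to `e (b k)` for every `k` and `e n` to `0` for every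
`n ∉ A`; see `spread_nth` and `spread_of_notMem`. -/
noncomputable def spread {H : Type*} [NormedAddCommGroup H] [InnerProductSpace ℂ H]
    [CompleteSpace H] (e : HilbertBasis ℕ ℂ H) (A B : Set ℕ) (hA : A.Infinite) (hB : B.Infinite) :
    H →L[ℂ] H :=
  (selectIsometry e B hB).toContinuousLinearMap ∘L
    ContinuousLinearMap.adjoint (selectIsometry e A hA).toContinuousLinearMap

theorem selectIsometry_single {H : Type*} [NormedAddCommGroup H] [InnerProductSpace ℂ H]
    [CompleteSpace H] (e : HilbertBasis ℕ ℂ H) (A : Set ℕ) (hA : A.Infinite) (k : ℕ) :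
    selectIsometry e A hA (lp.single 2 k (1 : ℂ)) = e (Nat.nth (fun n => n ∈ A) k) := by
  simp [selectIsometry, OrthogonalFamily.linearIsometry_apply_single]

theorem spread_nth {H : Type*} [NormedAddCommGroup H] [InnerProductSpace ℂ H]
    [CompleteSpace H] (e : HilbertBasis ℕ ℂ H) (A B : Set ℕ) (hA : A.Infinite) (hB : B.Infinite)
    (k : ℕ) :
    spread e A B hA hB (e (Nat.nth (fun n => n ∈ A) k)) = e (Nat.nth (fun n => n ∈ B) k) := by
  have h : ContinuousLinearMap.adjoint (selectIsometry e A hA).toContinuousLinearMap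
      (e (Nat.nth (fun n => n ∈ A) k)) = lp.single 2 k (1 : ℂ) := by
    refine ext_inner_right ℂ fun v => ?_
    rw [ContinuousLinearMap.adjoint_inner_left, ← selectIsometry_single e A hA k]
    exact (selectIsometry e A hA).inner_map_map _ _
  simp only [spread, ContinuousLinearMap.comp_apply, h]
  exact selectIsometry_single e B hB k

theorem spread_of_notMem {H : Type*} [NormedAddCommGroup H] [InnerProductSpace ℂ H]
    [CompleteSpace H] (e : HilbertBasis ℕ ℂ H) (A B : Set ℕ) (hA : A.Infinite) (hB : B.Infinite)
    (n : ℕ) (hn : n ∉ A) : spread e A B hA hB (e n) = 0 := by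
  have h : ContinuousLinearMap.adjoint (selectIsometry e A hA).toContinuousLinearMap (e n)
      = 0 := by
    ext k
    have h1 := lp.inner_single_left (𝕜 := ℂ) (G := fun _ : ℕ => ℂ) k (1 : ℂ)
      (ContinuousLinearMap.adjoint (selectIsometry e A hA).toContinuousLinearMap (e n))
    rw [ContinuousLinearMap.adjoint_inner_right] at h1
    have h2 : (selectIsometry e A hA).toContinuousLinearMap (lp.single 2 k (1 : ℂ))
        = e (Nat.nth (fun n => n ∈ A) k) := selectIsometry_single e A hA k
    have h3 : Nat.nth (fun n => n ∈ A) k ≠ n := by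
      rintro rfl
      exact hn (Nat.nth_mem_of_infinite hA k)
    rw [h2, e.orthonormal.inner_eq_zero h3] at h1
    simpa using h1.symm
  simp [spread, h]

/-- `U` is a unitary spread: a unitary operator which is the sum, in the strong operator topology,
of a series of spreads with respect to an orthonormal basis. -/
def IsUnitarySpread {H : Type*} [NormedAddCommGroup H] [InnerProductSpace ℂ H]
    [CompleteSpace H] (U : H →L[ℂ] H) : Prop :=
  U ∈ unitary (H →L[ℂ] H) ∧
    ∃ (e : HilbertBasis ℕ ℂ H) (A B : ℕ → Set ℕ)
      (hA : ∀ n, (A n).Infinite) (hB : ∀ n, (B n).Infinite),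
      ∀ x : H, Tendsto
        (fun N : ℕ => ∑ n ∈ Finset.range N, spread e (A n) (B n) (hA n) (hB n) x)
        atTop (𝓝 (U x))

/-- The open annulus `R°_{a,b} = {μ : a < |μ| < b}`. -/
def openAnnulus (a b : ℝ) : Set ℂ := {μ : ℂ | a < ‖μ‖ ∧ ‖μ‖ < b}

/-- `R` is a ring centred at `0`: all `μ` whose modulus lies in a non-degenerate interval `I` of
positive numbers, which may or may not contain its endpoints. -/
def IsRing (R : Set ℂ) : Prop :=
  ∃ I : Set ℝ, I.OrdConnected ∧ I.Nontrivial ∧ I ⊆ Set.Ioi 0 ∧ R = {μ : ℂ | ‖μ‖ ∈ I}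

end SchauderOp

/-!
A Schauder operator is injective: `T x = 0` with `x = ∑ cₙ eₙ` gives two expansions of `0` in the
columns `T eₙ`. Hence every eigenvalue of `U A` lies in the Schauder spectrum of `U A`, and it
suffices to choose `U` so that `U A` contains a bilateral weighted shift with many eigenvalues.

Suppose that unit vectors `fₖ` (`k : ℤ`) are such that the spaces `span {fₖ, A fₖ}` are pairwise
orthogonal. If `U` is unitary and maps the unit vector `A fₖ / ‖A fₖ‖` to `fₖ₊₁`, then
`U A fₖ = ‖A fₖ‖ fₖ₊₁`, and `μ` is an eigenvalue of `U A` as soon as the solution of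
`μ cₖ₊₁ = ‖A fₖ‖ cₖ` is square summable in both directions
(`mem_schauderSpectrum_of_bilateral_shift`). When the norms `‖A fₖ‖` tend to `l₁` at `+∞` and to
`l₂` at `-∞`, this is the case whenever `l₁ < |μ| < l₂`; for eigenvectors with the eigenvalues `tₖ`
to the right and `rₖ` to the left, the square sums are the two series assumed to be finite.

Such a `U` can be taken to be a unitary spread if infinitely many further vectors `g` are at hand
for which the spaces `span {g, A g}` are orthogonal to each other and to the ones before
(`exists_isUnitarySpread_apply_eq_smul`). They allow a decomposition of the space into pairwise
orthogonal infinite-dimensional closed subspaces `Mₖ` with `fₖ, A fₖ ∈ Mₖ`, and `U` is pieced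
together from unitaries `Mₖ → Mₖ₊₁` prescribed at one vector. Any such block shift permutes an
orthonormal basis indexed by `ℤ × ℕ`, namely the `U`-orbit of a basis of `M₀`, by
`(k, j) ↦ (k + 1, j)`; enumerated by the pairing function, which increases in `j`, each row is
mapped to the next one by a single spread (`isUnitarySpread_of_apply_pair`).

The vectors come from Weyl's criterion: for `l` in the essential spectrum of a self-adjoint `A`,
every subspace of finite codimension contains unit vectors on which `A - l` is arbitrarily small
(`exists_unit_norm_apply_lt_of_not_isFredholm`). Choosing each new vector orthogonal to `f`, `A f`
and `A² f` for all the earlier vectors `f` makes the spaces `span {f, A f}` orthogonal. In the case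
of a single point of the essential spectrum, the other spectral values are eigenvalues, because a
self-adjoint Fredholm operator without kernel is invertible; the further vectors are obtained by
setting aside a sparse subsequence of the eigenvectors, which changes the products by a bounded
factor only (`exists_strictMono_summable_prod`).
-/

namespace SchauderOp

open scoped InnerProductSpace

variable {H : Type*} [NormedAddCommGroup H] [InnerProductSpace ℂ H]

/-! ### Eigenvalues and the Schauder spectrum -/

/-- A Schauder operator is injective, by the uniqueness of the expansion of `0`. -/
theorem IsSchauderOperator.eq_zero_of_apply_eq_zero {T : H →L[ℂ] H} (hT : IsSchauderOperator T)
    {x : H} (hx : T x = 0) : x = 0 := by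
  obtain ⟨e, he⟩ := hT
  have h1 : Tendsto (fun N : ℕ => ∑ n ∈ Finset.range N, e.repr x n • T (e n)) atTop (𝓝 0) := by
    have h := ((e.hasSum_repr x).mapL T).tendsto_sum_nat
    simpa only [hx, map_smul] using h
  have h2 : Tendsto (fun N : ℕ => ∑ n ∈ Finset.range N, (0 : ℕ → ℂ) n • T (e n)) atTop (𝓝 0) := by
    simp
  have h3 : (fun n => e.repr x n) = 0 := (he 0).unique h1 h2
  have h4 := e.hasSum_repr x
  have h5 : (fun i => e.repr x i • e i) = fun _ => 0 := by
    funext i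
    rw [show e.repr x i = 0 from congrFun h3 i, zero_smul]
  rw [h5] at h4
  exact h4.unique hasSum_zero

theorem mem_schauderSpectrum_of_apply_eq_smul {T : H →L[ℂ] H} {μ : ℂ} {x : H} (hx : x ≠ 0)
    (h : T x = μ • x) : μ ∈ schauderSpectrum T := fun hS =>
  hx (hS.eq_zero_of_apply_eq_zero (by simp [h]))

/-! ### Weyl's criterion for self-adjoint operators -/

section Fredholm

variable [CompleteSpace H]

/-- Weyl's criterion: a self-adjoint operator which is not Fredholm is not bounded below on any
closed subspace of finite codimension. Indeed, if it were, its kernel would be finite-dimensional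
and its range closed, and the orthogonal complement of the range is the kernel. -/
theorem exists_unit_norm_apply_lt_of_not_isFredholm {T : H →L[ℂ] H} (hT : IsSelfAdjoint T)
    (hF : ¬ T.IsFredholm) (F : Submodule ℂ H) [FiniteDimensional ℂ F] {ε : ℝ} (hε : 0 < ε) :
    ∃ x ∈ Fᗮ, ‖x‖ = 1 ∧ ‖T x‖ < ε := by
  by_contra! hcon
  have hbelow : ∀ x ∈ Fᗮ, ε * ‖x‖ ≤ ‖T x‖ := by
    intro x hx
    rcases eq_or_ne x 0 with rfl | h0
    · simp
    have hn : 0 < ‖x‖ := norm_pos_iff.2 h0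
    have h := hcon (((‖x‖⁻¹ : ℝ) : ℂ) • x) (Fᗮ.smul_mem _ hx)
      (by rw [norm_smul]; simp [hn.ne'])
    rw [map_smul, norm_smul, Complex.norm_real, norm_inv, norm_norm, inv_mul_eq_div,
      le_div_iff₀ hn] at h
    exact h
  have hclosed : IsClosed (Fᗮ : Set H) := F.isClosed_orthogonal
  have hco : Fᗮ.CoFG := Submodule.FG.cofg_of_isCompl
    (Submodule.isCompl_orthogonal (K := F))
    ((Submodule.fg_iff_finiteDimensional F).2 inferInstance)
  have hanti : AntilipschitzWith (Real.toNNReal ε⁻¹) (T.domRestrict Fᗮ) := by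
    refine ContinuousLinearMap.antilipschitz_of_bound _ fun x => ?_
    rw [Real.coe_toNNReal _ (by positivity), inv_mul_eq_div, le_div_iff₀ hε, mul_comm]
    exact hbelow x x.2
  have hemb := hanti.isClosedEmbedding (T.domRestrict Fᗮ).uniformContinuous
  obtain ⟨hstrict, hrange⟩ := (T.isStrictMap_isClosed_range_iff_restrict Fᗮ hclosed).2
    ⟨hemb.isEmbedding.isStrictMap, hemb.isClosed_range⟩
  have hdisj : Disjoint T.ker Fᗮ := by
    rw [Submodule.disjoint_def]
    intro x hx hxF
    have h := hbelow x hxF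
    rw [show T x = 0 from hx, norm_zero] at h
    exact norm_le_zero_iff.1 (nonpos_of_mul_nonpos_right h hε)
  have hker : FiniteDimensional ℂ T.ker :=
    (Submodule.fg_iff_finiteDimensional _).1 (hco.fg_of_disjoint hdisj)
  have horth : T.rangeᗮ = T.ker := by
    rw [ContinuousLinearMap.orthogonal_range, hT.adjoint_eq]
  refine hF ⟨hstrict, hrange, hker, ?_, ?_⟩
  · have : CompleteSpace T.range := hrange.completeSpace_coe
    have hc := Submodule.isCompl_orthogonal (K := T.range)
    rw [horth] at hc
    exact Submodule.FG.cofg_of_isCompl hc.symm ((Submodule.fg_iff_finiteDimensional _).2 hker)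
  · exact Submodule.ClosedComplemented.of_finiteDimensional _

theorem exists_unit_apply_eq_zero_of_isFredholm {T : H →L[ℂ] H} (hT : IsSelfAdjoint T)
    (hF : T.IsFredholm) (hu : ¬ IsUnit T) : ∃ x, ‖x‖ = 1 ∧ T x = 0 := by
  by_contra! hcon
  have hker : T.ker = ⊥ := by
    rw [Submodule.eq_bot_iff]
    intro x hx
    by_contra h0
    refine hcon (((‖x‖⁻¹ : ℝ) : ℂ) • x) (by rw [norm_smul]; simp [h0]) ?_
    rw [map_smul, show T x = 0 from hx, smul_zero]
  have hrange : T.range = ⊤ := by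
    have : CompleteSpace T.range := hF.isClosed_range.completeSpace_coe
    rw [← Submodule.orthogonal_eq_bot_iff, ContinuousLinearMap.orthogonal_range, hT.adjoint_eq,
      hker]
  exact hu (ContinuousLinearMap.isUnit_iff_bijective.2
    ⟨LinearMap.ker_eq_bot.1 hker, LinearMap.range_eq_top.1 hrange⟩)

theorem isSelfAdjoint_smul_id_sub {A : H →L[ℂ] H} (hA : IsSelfAdjoint A) (l : ℝ) :
    IsSelfAdjoint ((l : ℂ) • ContinuousLinearMap.id ℂ H - A) := by
  refine IsSelfAdjoint.sub ?_ hA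
  have : IsSelfAdjoint (ContinuousLinearMap.id ℂ H) := IsSelfAdjoint.one _
  exact IsSelfAdjoint.smul (Complex.conj_ofReal l) this

theorem exists_unit_eigenvector {A : H →L[ℂ] H} (hA : IsSelfAdjoint A) {t : ℝ}
    (ht : (t : ℂ) ∈ spectrum ℂ A) (ht' : (t : ℂ) ∉ essentialSpectrum A) :
    ∃ x, ‖x‖ = 1 ∧ A x = (t : ℂ) • x := by
  obtain ⟨x, hx, h0⟩ := exists_unit_apply_eq_zero_of_isFredholm (isSelfAdjoint_smul_id_sub hA t)
    (not_not.1 ht') (by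
      rw [spectrum.mem_iff, Algebra.algebraMap_eq_smul_one] at ht
      exact ht)
  exact ⟨x, hx, (sub_eq_zero.1 (by simpa using h0)).symm⟩

/-- Only the norm of `A x` is recorded, since this is the weight of the shift built from `x`. -/
theorem exists_unit_approx_eigenvector {A : H →L[ℂ] H} (hA : IsSelfAdjoint A) {l : ℝ}
    (hl : (l : ℂ) ∈ essentialSpectrum A) (s : Finset H) {ε : ℝ} (hε : 0 < ε) :
    ∃ x, ‖x‖ = 1 ∧ |‖A x‖ - ‖l‖| < ε ∧ ∀ y ∈ s, ⟪y, x⟫_ℂ = 0 := by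
  obtain ⟨x, hxF, hx, h⟩ := exists_unit_norm_apply_lt_of_not_isFredholm
    (isSelfAdjoint_smul_id_sub hA l) hl (Submodule.span ℂ (s : Set H)) hε
  refine ⟨x, hx, ?_, fun y hy => (Submodule.mem_orthogonal _ _).1 hxF y
    (Submodule.subset_span hy)⟩
  refine lt_of_le_of_lt ?_ h
  have h2 := abs_norm_sub_norm_le (A x) ((l : ℂ) • x)
  rw [norm_smul, hx, mul_one, Complex.norm_real, norm_sub_rev] at h2
  simpa using h2

end Fredholm

/-- Greedy choice of a sequence in which every vector is orthogonal to `x`, `A x` and `A (A x)` for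
each earlier `x`. For self-adjoint `A` this makes the spaces `span {x, A x}` pairwise orthogonal. -/
theorem exists_seq_of_forall_finset {Q : ℕ → H → Prop}
    (h : ∀ n (s : Finset H), ∃ x, Q n x ∧ ∀ y ∈ s, ⟪y, x⟫_ℂ = 0) (A : H →L[ℂ] H) :
    ∃ φ : ℕ → H, (∀ n, Q n (φ n)) ∧ ∀ m n, m < n →
      ⟪φ m, φ n⟫_ℂ = 0 ∧ ⟪A (φ m), φ n⟫_ℂ = 0 ∧ ⟪A (A (φ m)), φ n⟫_ℂ = 0 := by
  classical
  choose g hg hg' using h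
  -- `S n` collects the vectors to which the `n`-th choice has to be orthogonal
  let S : ℕ → Finset H := fun n => Nat.rec ∅
    (fun n s => s ∪ {g n s, A (g n s), A (A (g n s))}) n
  have hS : ∀ n, S (n + 1) = S n ∪ {g n (S n), A (g n (S n)), A (A (g n (S n)))} := fun n => rfl
  have hmono : Monotone S := monotone_nat_of_le_succ fun n => by
    rw [hS]
    exact Finset.subset_union_left
  refine ⟨fun n => g n (S n), fun n => hg n _, fun m n hmn => ?_⟩
  have hsub : S (m + 1) ⊆ S n := hmono hmn
  rw [hS] at hsub
  refine ⟨hg' n _ _ (hsub ?_), hg' n _ _ (hsub ?_), hg' n _ _ (hsub ?_)⟩ <;> simp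

/-! ### Permutations of an orthonormal basis as unitary spreads -/

theorem nth_mem_range_of_strictMono {f : ℕ → ℕ} (hf : StrictMono f) :
    Nat.nth (fun n => n ∈ Set.range f) = f := by
  have hinf : (Set.range f).Infinite := Set.infinite_range_of_injective hf.injective
  refine ((Nat.nth_strictMono hinf).range_inj hf).1 ?_
  exact Nat.range_nth_of_infinite hinf

theorem strictMono_pair (n : ℕ) : StrictMono (Nat.pair n) := fun _ _ h =>
  Nat.pair_lt_pair_right n h

/-- A unitary which maps the rows `{⟨n, j⟩ | j}` of an orthonormal basis, indexed through the
pairing function, onto rows is a unitary spread: as the pairing function increases in `j`, its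
restriction to each row is a spread. -/
theorem isUnitarySpread_of_apply_pair [CompleteSpace H] (U : H ≃ₗᵢ[ℂ] H)
    (e : HilbertBasis ℕ ℂ H) (τ : ℕ → ℕ)
    (hU : ∀ n j, U (e (Nat.pair n j)) = e (Nat.pair (τ n) j)) :
    IsUnitarySpread (U.toContinuousLinearEquiv : H →L[ℂ] H) := by
  have hinf : ∀ n, (Set.range (Nat.pair n)).Infinite := fun n =>
    Set.infinite_range_of_injective (strictMono_pair n).injective
  refine ⟨?_, e, fun n => Set.range (Nat.pair n), fun n => Set.range (Nat.pair (τ n)),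
    fun n => hinf n, fun n => hinf (τ n), fun x => ?_⟩
  · exact (Unitary.linearIsometryEquiv.symm U).2
  · set S : ℕ → H →L[ℂ] H := fun n => spread e _ _ (hinf n) (hinf (τ n)) with hS
    have hsame : ∀ n j, S n (e (Nat.pair n j)) = U (e (Nat.pair n j)) := by
      intro n j
      have h := spread_nth e _ _ (hinf n) (hinf (τ n)) j
      rw [nth_mem_range_of_strictMono (strictMono_pair n),
        nth_mem_range_of_strictMono (strictMono_pair (τ n))] at h
      rw [hU]
      exact h
    have hdiff : ∀ n i, i ∉ Set.range (Nat.pair n) → S n (e i) = 0 := fun n i hi =>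
      spread_of_notMem e _ _ (hinf n) (hinf (τ n)) i hi
    have hsum := e.hasSum_repr x
    have hx : HasSum (fun p : ℕ × ℕ => e.repr x (Nat.pair p.1 p.2) • U (e (Nat.pair p.1 p.2)))
        (U x) := by
      have h := (Nat.pairEquiv.hasSum_iff).2
        (hsum.mapL (U.toContinuousLinearEquiv : H →L[ℂ] H))
      simpa [Function.comp_def, Function.uncurry] using h
    have hrow : ∀ n, HasSum
        (fun j => e.repr x (Nat.pair n j) • U (e (Nat.pair n j))) (S n x) := by
      intro n
      have h := hsum.mapL (S n)
      rw [← (strictMono_pair n).injective.hasSum_iff] at h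
      · simpa [Function.comp_def, hsame] using h
      · intro i hi
        rw [map_smul, hdiff n i hi, smul_zero]
    exact (hx.prod_fiberwise hrow).tendsto_sum_nat

/-! ### Orthonormal bases of separable spaces -/

theorem countable_of_orthonormal [TopologicalSpace.SeparableSpace H] {s : Set H}
    (hs : Orthonormal ℂ ((↑) : s → H)) : s.Countable := by
  refine Set.PairwiseDisjoint.countable_of_isOpen (s := fun x : H => Metric.ball x (1 / 2)) ?_
    (fun _ _ => Metric.isOpen_ball) (fun x _ => ⟨x, Metric.mem_ball_self (by norm_num)⟩)
  intro x hx y hy hxy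
  refine Metric.ball_disjoint_ball ?_
  have h0 : ⟪x, y⟫_ℂ = 0 := hs.2 (i := ⟨x, hx⟩) (j := ⟨y, hy⟩) (by simpa using hxy)
  have hx1 : ‖x‖ = 1 := hs.1 ⟨x, hx⟩
  have hy1 : ‖y‖ = 1 := hs.1 ⟨y, hy⟩
  have h2 := norm_sub_sq (𝕜 := ℂ) x y
  rw [h0, hx1, hy1, map_zero] at h2
  rw [dist_eq_norm]
  nlinarith [norm_nonneg (x - y)]

theorem separableSpace_of_hilbertBasis (e : HilbertBasis ℕ ℂ H) :
    TopologicalSpace.SeparableSpace H := by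
  have h : TopologicalSpace.IsSeparable
      ((Submodule.span ℂ (Set.range e)).topologicalClosure : Set H) :=
    ((Set.countable_range e).isSeparable.span (R := ℂ)).closure
  rw [e.dense_span] at h
  exact TopologicalSpace.isSeparable_univ_iff.1 h

theorem exists_hilbertBasis_nat_zero_eq [CompleteSpace H] [TopologicalSpace.SeparableSpace H]
    (hdim : ¬ FiniteDimensional ℂ H) {x : H} (hx : ‖x‖ = 1) :
    ∃ b : HilbertBasis ℕ ℂ H, b 0 = x := by
  have hx' : Orthonormal ℂ ((↑) : ({x} : Set H) → H) :=
    ⟨fun i => by rw [show (i : H) = x from i.2, hx],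
      fun i j hij => (hij (Subsingleton.elim _ _)).elim⟩
  obtain ⟨w, b, hw, hb⟩ := hx'.exists_hilbertBasis_extension
  have ho : Orthonormal ℂ ((↑) : w → H) := hb ▸ b.orthonormal
  have hc : Countable w := (countable_of_orthonormal ho).to_subtype
  have hi : Infinite w := by
    by_contra hfin
    rw [not_infinite_iff_finite] at hfin
    have := Fintype.ofFinite w
    exact hdim b.toOrthonormalBasis.toBasis.finiteDimensional_of_finite
  classical
  obtain ⟨d⟩ := nonempty_denumerable w
  let v : ℕ ≃ w := d.eqv.symm
  let v' : ℕ ≃ w := v.trans (Equiv.swap (v 0) ⟨x, hw rfl⟩)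
  have hspan : Set.range (fun n => (v' n : H)) = Set.range b := by
    rw [hb]
    exact v'.surjective.range_comp ((↑) : w → H)
  refine ⟨HilbertBasis.mk (v := fun n => (v' n : H)) (ho.comp _ v'.injective) ?_, ?_⟩
  · rw [hspan, b.dense_span]
  · simp [v']

/-! ### Block shifts -/

/-- A unitary `U` which maps `M k` onto `M (k + 1)`, for an orthogonal decomposition of the space,
is a unitary spread: the vectors `U ^ k (b j)`, for a basis `b` of `M 0`, form an orthonormal basis
which `U` permutes row by row. -/
theorem isUnitarySpread_of_map_block [CompleteSpace H] (U : H ≃ₗᵢ[ℂ] H)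
    {M : ℤ → Submodule ℂ H}
    (hM : OrthogonalFamily ℂ (fun k => M k) fun k => (M k).subtypeₗᵢ)
    (htop : (⨆ k, M k)ᗮ = ⊥) (hU : ∀ k, ∀ x ∈ M k, U x ∈ M (k + 1))
    (hU' : ∀ k, ∀ x ∈ M (k + 1), U.symm x ∈ M k) (b : HilbertBasis ℕ ℂ (M 0)) :
    IsUnitarySpread (U.toContinuousLinearEquiv : H →L[ℂ] H) := by
  have hpow : ∀ k : ℤ, (∀ x ∈ M 0, (U ^ k) x ∈ M k) ∧ ∀ x ∈ M k, (U ^ (-k)) x ∈ M 0 := by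
    intro k
    induction k with
    | zero => simp
    | succ k ih =>
      refine ⟨fun x hx => ?_, fun x hx => ?_⟩
      · rw [add_comm, zpow_add, zpow_one, add_comm]
        exact hU _ _ (ih.1 x hx)
      · rw [neg_add, zpow_add, zpow_neg_one]
        exact ih.2 _ (hU' _ _ hx)
    | pred k ih =>
      have hk : (-(k : ℤ)) = (-(k : ℤ) - 1) + 1 := by ring
      refine ⟨fun x hx => ?_, fun x hx => ?_⟩
      · rw [sub_eq_neg_add, zpow_add, zpow_neg_one, ← sub_eq_neg_add]
        refine hU' _ _ ?_
        rw [← hk]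
        exact ih.1 x hx
      · rw [neg_sub, sub_eq_neg_add, zpow_add, zpow_one]
        refine ih.2 _ ?_
        have := hU _ _ hx
        rwa [← hk] at this
  -- the orthonormal basis permuted by `U`, indexed by the level `k` and the position `j`
  let c : ℤ → ℕ → H := fun k j => (U ^ k) (b j)
  have hcM : ∀ k j, c k j ∈ M k := fun k j => (hpow k).1 _ (b j).2
  have hc : ∀ k l i j, ⟪c k i, c l j⟫_ℂ = if k = l ∧ i = j then 1 else 0 := by
    intro k l i j
    by_cases hkl : k = l
    · subst hkl
      rw [LinearIsometryEquiv.inner_map_map, ← Submodule.coe_inner,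
        orthonormal_iff_ite.1 b.orthonormal]
      simp
    · rw [if_neg (fun h => hkl h.1)]
      exact hM hkl ⟨_, hcM k i⟩ ⟨_, hcM l j⟩
  have hUc : ∀ k j, U (c k j) = c (k + 1) j := by
    intro k j
    simp only [c]
    rw [add_comm, zpow_add, zpow_one]
    rfl
  let z : ℕ ≃ ℤ := (Denumerable.eqv ℤ).symm
  let v : ℕ → H := fun n => c (z n.unpair.1) n.unpair.2
  have hv : Orthonormal ℂ v := by
    rw [orthonormal_iff_ite]
    intro m n
    rw [hc]
    refine if_congr ?_ rfl rfl
    rw [z.injective.eq_iff, ← Prod.ext_iff]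
    exact Nat.pairEquiv.symm.injective.eq_iff
  have hspan : (Submodule.span ℂ (Set.range v))ᗮ = ⊥ := by
    rw [Submodule.eq_bot_iff]
    intro y hy
    have hy' : ∀ k j, ⟪c k j, y⟫_ℂ = 0 := by
      intro k j
      refine (Submodule.mem_orthogonal _ _).1 hy _
        (Submodule.subset_span ⟨Nat.pair (z.symm k) j, ?_⟩)
      simp [v]
    have hy2 : y ∈ (⨆ k, M k)ᗮ := by
      have hle : (⨆ k, M k) ≤ (ℂ ∙ y)ᗮ := by
        refine iSup_le fun k m hm => Submodule.mem_orthogonal_singleton_iff_inner_right.2 ?_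
        have h := (((b.hasSum_repr ⟨_, (hpow k).2 m hm⟩).mapL (M 0).subtypeL).mapL
          ((U ^ k).toContinuousLinearEquiv : H →L[ℂ] H)).mapL (innerSL ℂ y)
        have hm' : (U ^ k) ((U ^ (-k)) m) = m := by
          rw [zpow_neg]
          exact (U ^ k).apply_symm_apply m
        have hzero : ∀ j, ⟪y, (U ^ k) (b j)⟫_ℂ = 0 := fun j => inner_eq_zero_symm.1 (hy' k j)
        simp only [map_smul, Submodule.subtypeL_apply, ContinuousLinearEquiv.coe_coe,
          LinearIsometryEquiv.coe_toContinuousLinearEquiv, innerSL_apply_apply, hzero, smul_zero,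
          hm'] at h
        exact h.unique hasSum_zero
      exact (Submodule.mem_orthogonal _ _).2 fun u hu =>
        Submodule.mem_orthogonal_singleton_iff_inner_left.1 (hle hu)
    rwa [htop] at hy2
  refine isUnitarySpread_of_apply_pair U (HilbertBasis.mkOfOrthogonalEqBot hv hspan)
    (fun n => z.symm (z n + 1)) fun n j => ?_
  simp [v, hUc]

/-- Block shifts with a prescribed value at one unit vector of each block. -/
theorem exists_isUnitarySpread_of_orthogonalFamily [CompleteSpace H]
    [TopologicalSpace.SeparableSpace H] {M : ℤ → Submodule ℂ H} (hcl : ∀ k, IsClosed (M k : Set H))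
    (hM : OrthogonalFamily ℂ (fun k => M k) fun k => (M k).subtypeₗᵢ)
    (htop : (⨆ k, M k)ᗮ = ⊥) (hdim : ∀ k, ¬ FiniteDimensional ℂ (M k)) (x y : ℤ → H)
    (hxM : ∀ k, x k ∈ M k) (hyM : ∀ k, y k ∈ M k) (hx : ∀ k, ‖x k‖ = 1) (hy : ∀ k, ‖y k‖ = 1) :
    ∃ U : H →L[ℂ] H, IsUnitarySpread U ∧ ∀ k, U (x k) = y (k + 1) := by
  have hcomp : ∀ k, CompleteSpace (M k) := fun k => (hcl k).completeSpace_coe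
  choose p hp using fun k => exists_hilbertBasis_nat_zero_eq (hdim k) (x := ⟨x k, hxM k⟩) (hx k)
  choose q hq using fun k => exists_hilbertBasis_nat_zero_eq (hdim k) (x := ⟨y k, hyM k⟩) (hy k)
  let V : ∀ k, M k ≃ₗᵢ[ℂ] M (k + 1) := fun k => (p k).repr.trans (q (k + 1)).repr.symm
  have hV : ∀ k, V k ⟨x k, hxM k⟩ = ⟨y (k + 1), hyM (k + 1)⟩ := by
    intro k
    rw [← hp, ← hq, LinearIsometryEquiv.trans_apply, HilbertBasis.repr_self,
      HilbertBasis.repr_symm_single]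
  let W : ∀ k, M k →ₗᵢ[ℂ] H := fun k => (M (k + 1)).subtypeₗᵢ.comp (V k).toLinearIsometry
  have h1 : IsHilbertSum ℂ (fun k => M k) fun k => (M k).subtypeₗᵢ := by
    refine IsHilbertSum.mkInternal _ hM ?_
    rw [top_le_iff, Submodule.topologicalClosure_eq_top_iff, htop]
  have hW : OrthogonalFamily ℂ (fun k => M k) W := fun k l hkl a b =>
    hM (fun h => hkl (add_right_cancel h)) (V k a) (V l b)
  have h2 : IsHilbertSum ℂ (fun k => M k) W := by
    refine IsHilbertSum.mk hW ?_
    rw [top_le_iff, Submodule.topologicalClosure_eq_top_iff, eq_bot_iff, ← htop]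
    refine Submodule.orthogonal_le (iSup_le fun k m hm => ?_)
    obtain ⟨l, rfl⟩ : ∃ l, k = l + 1 := ⟨k - 1, by ring⟩
    refine Submodule.mem_iSup_of_mem l ⟨(V l).symm ⟨m, hm⟩, ?_⟩
    change ((V l ((V l).symm ⟨m, hm⟩) : M (l + 1)) : H) = m
    rw [LinearIsometryEquiv.apply_symm_apply]
  let U : H ≃ₗᵢ[ℂ] H := h1.linearIsometryEquiv.trans h2.linearIsometryEquiv.symm
  have hUW : ∀ k (m : M k), U m = V k m := by
    intro k m
    have h : h1.linearIsometryEquiv (m : H) = lp.single 2 k m := by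
      rw [← LinearIsometryEquiv.eq_symm_apply, h1.linearIsometryEquiv_symm_apply_single]
      rfl
    rw [LinearIsometryEquiv.trans_apply, h, h2.linearIsometryEquiv_symm_apply_single]
    rfl
  refine ⟨_, isUnitarySpread_of_map_block U hM htop ?_ ?_ (p 0), fun k => ?_⟩
  · intro k m hm
    rw [hUW k ⟨m, hm⟩]
    exact Subtype.coe_prop _
  · intro k m hm
    have h := hUW k ((V k).symm ⟨m, hm⟩)
    rw [LinearIsometryEquiv.apply_symm_apply, ← LinearIsometryEquiv.eq_symm_apply] at h
    rw [← h]
    exact Subtype.coe_prop _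
  · have h := hUW k ⟨x k, hxM k⟩
    rw [hV] at h
    exact h

/-- The vectors `f (.inr n)` carry no condition on `U`; they make the blocks
infinite-dimensional. -/
theorem exists_isUnitarySpread_apply_eq_smul [CompleteSpace H]
    [TopologicalSpace.SeparableSpace H] (A : H →L[ℂ] H) {f : ℤ ⊕ ℕ → H} (hf : Orthonormal ℂ f)
    (hfA : Pairwise fun i j => ⟪f i, A (f j)⟫_ℂ = 0)
    (hAA : Pairwise fun i j => ⟪A (f i), A (f j)⟫_ℂ = 0) (h0 : ∀ k, A (f (.inl k)) ≠ 0) :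
    ∃ U : H →L[ℂ] H, IsUnitarySpread U ∧
      ∀ k : ℤ, U (A (f (.inl k))) = (‖A (f (.inl k))‖ : ℂ) • f (.inl (k + 1)) := by
  -- the level to which the `i`-th vector is assigned: each level receives one vector with an
  -- integer index, and infinitely many of the others
  let z : ℕ ≃ ℤ := (Denumerable.eqv ℤ).symm
  let lev : ℤ ⊕ ℕ → ℤ := Sum.elim id fun n => z n.unpair.1
  let S : ℤ → Set H := fun k => {x | ∃ i, lev i = k ∧ (x = f i ∨ x = A (f i))}
  let C : ℤ → Submodule ℂ H := fun k => (Submodule.span ℂ (S k)).topologicalClosure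
  have hS : ∀ k l, k ≠ l → ∀ x ∈ S k, ∀ y ∈ S l, ⟪x, y⟫_ℂ = 0 := by
    rintro _ _ hkl x ⟨i, rfl, hi⟩ y ⟨j, rfl, hj⟩
    have hij : i ≠ j := fun h => hkl (congrArg lev h)
    rcases hi with rfl | rfl <;> rcases hj with rfl | rfl
    · exact hf.2 hij
    · exact hfA hij
    · exact inner_eq_zero_symm.1 (hfA hij.symm)
    · exact hAA hij
  have hC : ∀ k l, k ≠ l → C k ⟂ C l := by
    intro k l hkl
    have h : Submodule.span ℂ (S k) ⟂ Submodule.span ℂ (S l) :=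
      Submodule.isOrtho_span.2 fun {u} hu {v} hv => hS k l hkl u hu v hv
    have h1 : C k ⟂ Submodule.span ℂ (S l) :=
      Submodule.topologicalClosure_minimal _ h (Submodule.isClosed_orthogonal _)
    have h2 : C l ⟂ C k :=
      Submodule.topologicalClosure_minimal _ h1.symm (Submodule.isClosed_orthogonal _)
    exact h2.symm
  -- level `0` is enlarged to the orthogonal complement of all the others
  let M : ℤ → Submodule ℂ H := fun k => if k = 0 then (⨆ l : {l : ℤ // l ≠ 0}, C l)ᗮ else C k
  have hM0 : M 0 = (⨆ l : {l : ℤ // l ≠ 0}, C l)ᗮ := if_pos rfl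
  have hMne : ∀ k, k ≠ 0 → M k = C k := fun k hk => if_neg hk
  have hCM : ∀ k, C k ≤ M k := by
    intro k
    rcases eq_or_ne k 0 with rfl | hk
    · rw [hM0]
      have h : C 0 ⟂ ⨆ l : {l : ℤ // l ≠ 0}, C l :=
        Submodule.isOrtho_iSup_right.2 fun l => hC 0 l l.2.symm
      exact h
    · exact (hMne k hk).ge
  have hM0k : ∀ k, k ≠ 0 → M 0 ⟂ M k := by
    intro k hk
    rw [hM0, hMne k hk]
    exact Submodule.orthogonal_le (le_iSup (fun l : {l : ℤ // l ≠ 0} => C l) ⟨k, hk⟩)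
  have hM : OrthogonalFamily ℂ (fun k => M k) fun k => (M k).subtypeₗᵢ := by
    refine OrthogonalFamily.of_pairwise fun k l hkl => ?_
    rcases eq_or_ne k 0 with rfl | hk
    · exact hM0k l hkl.symm
    rcases eq_or_ne l 0 with rfl | hl
    · exact (hM0k k hk).symm
    change M k ⟂ M l
    rw [hMne k hk, hMne l hl]
    exact hC k l hkl
  have htop : (⨆ k, M k)ᗮ = ⊥ := by
    have h1 : (⨆ k, M k)ᗮ ≤ M 0 := by
      rw [hM0]
      refine Submodule.orthogonal_le (iSup_le fun l => ?_)
      exact (hCM l).trans (le_iSup M l)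
    have h2 : (⨆ k, M k)ᗮ ≤ (M 0)ᗮ := Submodule.orthogonal_le (le_iSup M 0)
    rw [eq_bot_iff, ← Submodule.inf_orthogonal_eq_bot (M 0)]
    exact le_inf h1 h2
  have hcl : ∀ k, IsClosed (M k : Set H) := by
    intro k
    rcases eq_or_ne k 0 with rfl | hk
    · rw [hM0]
      exact Submodule.isClosed_orthogonal _
    · rw [hMne k hk]
      exact Submodule.isClosed_topologicalClosure _
  have hSM : ∀ k, ∀ x ∈ S k, x ∈ M k := fun k x hx =>
    hCM k (Submodule.le_topologicalClosure _ (Submodule.subset_span hx))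
  have hdim : ∀ k, ¬ FiniteDimensional ℂ (M k) := by
    intro k hfin
    let w : ℕ → M k := fun j => ⟨f (.inr (Nat.pair (z.symm k) j)),
      hSM k _ ⟨_, by simp [lev], Or.inl rfl⟩⟩
    have hw : Orthonormal ℂ w := by
      have : Orthonormal ℂ fun j => f (.inr (Nat.pair (z.symm k) j)) :=
        hf.comp _ (Sum.inr_injective.comp (strictMono_pair _).injective)
      exact ⟨fun j => this.1 j, fun i j hij => this.2 hij⟩
    have := hw.linearIndependent.finite
    exact not_finite ℕ
  obtain ⟨U, hU, hU'⟩ := exists_isUnitarySpread_of_orthogonalFamily hcl hM htop hdim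
    (fun k => ((‖A (f (.inl k))‖⁻¹ : ℝ) : ℂ) • A (f (.inl k))) (fun k => f (.inl k))
    (fun k => (M k).smul_mem _ (hSM k _ ⟨.inl k, rfl, Or.inr rfl⟩))
    (fun k => hSM k _ ⟨.inl k, rfl, Or.inl rfl⟩)
    (fun k => by rw [norm_smul]; simp [h0 k]) (fun k => hf.1 _)
  refine ⟨U, hU, fun k => ?_⟩
  have hn : (‖A (f (.inl k))‖ : ℂ) ≠ 0 := by simpa using h0 k
  rw [← hU' k, map_smul, smul_smul, Complex.ofReal_inv, mul_inv_cancel₀ hn, one_smul]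

/-! ### Eigenvectors of bilateral weighted shifts -/

/-- The eigenvector is `∑ c k • f k`, where `c 0 = 1` and `μ * c (k + 1) = a k * c k`; the
hypotheses say that `c` is square summable to the right and to the left. -/
theorem mem_schauderSpectrum_of_bilateral_shift [CompleteSpace H] {T : H →L[ℂ] H} {f : ℤ → H}
    (hf : Orthonormal ℂ f) {a : ℤ → ℝ} (ha : ∀ k, a k ≠ 0)
    (hT : ∀ k, T (f k) = (a k : ℂ) • f (k + 1)) {μ : ℂ} (hμ : μ ≠ 0)
    (hpos : Summable fun n : ℕ => ∏ k ∈ Finset.range (n + 1), (a k / ‖μ‖) ^ 2)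
    (hneg : Summable fun n : ℕ => ∏ k ∈ Finset.range (n + 1), (‖μ‖ / a (Int.negSucc k)) ^ 2) :
    μ ∈ schauderSpectrum T := by
  let c : ℤ → ℂ := fun k => match k with
    | Int.ofNat n => ∏ k ∈ Finset.range n, ((a k : ℂ) / μ)
    | Int.negSucc n => ∏ k ∈ Finset.range (n + 1), (μ / (a (Int.negSucc k) : ℂ))
  have hc : ∀ k, μ * c (k + 1) = a k * c k := by
    intro k
    match k with
    | Int.ofNat n =>
      change μ * ∏ k ∈ Finset.range (n + 1), ((a k : ℂ) / μ) =
        a n * ∏ k ∈ Finset.range n, ((a k : ℂ) / μ)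
      rw [Finset.prod_range_succ]
      field_simp
    | Int.negSucc 0 =>
      have h : (a (Int.negSucc 0) : ℂ) ≠ 0 := by exact_mod_cast ha _
      change μ * ∏ k ∈ Finset.range 0, ((a k : ℂ) / μ) = a (Int.negSucc 0) *
        ∏ k ∈ Finset.range (0 + 1), (μ / (a (Int.negSucc k) : ℂ))
      rw [zero_add, Finset.prod_range_one, Finset.prod_range_zero]
      field_simp
    | Int.negSucc (n + 1) =>
      have h : (a (Int.negSucc (n + 1)) : ℂ) ≠ 0 := by exact_mod_cast ha _
      change μ * ∏ k ∈ Finset.range (n + 1), (μ / (a (Int.negSucc k) : ℂ)) =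
        a (Int.negSucc (n + 1)) * ∏ k ∈ Finset.range (n + 1 + 1), (μ / (a (Int.negSucc k) : ℂ))
      rw [Finset.prod_range_succ _ (n + 1)]
      field_simp
  have hsum : Summable fun k => ‖c k‖ ^ 2 := by
    refine Summable.of_nat_of_neg_add_one ?_ ?_
    · refine (summable_nat_add_iff 1).1 (hpos.congr fun n => ?_)
      change _ = ‖∏ k ∈ Finset.range (n + 1), ((a k : ℂ) / μ)‖ ^ 2
      rw [norm_prod, ← Finset.prod_pow]
      refine Finset.prod_congr rfl fun k _ => ?_
      rw [norm_div, Complex.norm_real, div_pow, div_pow, Real.norm_eq_abs, sq_abs]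
    · refine hneg.congr fun n => ?_
      rw [← Int.negSucc_eq]
      change _ = ‖∏ k ∈ Finset.range (n + 1), (μ / (a (Int.negSucc k) : ℂ))‖ ^ 2
      rw [norm_prod, ← Finset.prod_pow]
      refine Finset.prod_congr rfl fun k _ => ?_
      rw [norm_div, Complex.norm_real, div_pow, div_pow, Real.norm_eq_abs, sq_abs]
  obtain ⟨x, hx⟩ : Summable fun k => c k • f k := by
    simpa using (hf.orthogonalFamily.summable_iff_norm_sq_summable c).2 hsum
  refine mem_schauderSpectrum_of_apply_eq_smul (x := x) ?_ ?_
  · rintro rfl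
    have h := hx.mapL (innerSL ℂ (f 0))
    have h' : HasSum (fun k => innerSL ℂ (f 0) (c k • f k)) (c 0) := by
      convert hasSum_single (0 : ℤ) fun k hk => ?_ using 1
      · simp [hf.1 0]
      · simp [hf.2 hk.symm]
    have h0 : c 0 = 0 := by simpa using h'.unique h
    have h1 : c 0 = ∏ k ∈ Finset.range 0, ((a k : ℂ) / μ) := rfl
    simp [h1] at h0
  · have h1 : HasSum (fun k => (μ * c (k + 1)) • f (k + 1)) (T x) := by
      convert hx.mapL T using 2 with k
      rw [map_smul, hT, smul_smul, hc, mul_comm]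
    have h2 : HasSum (fun k => (μ * c (k + 1)) • f (k + 1)) (μ • x) := by
      have h := (Equiv.addRight (1 : ℤ)).hasSum_iff.2 (hx.const_smul μ)
      simpa [Function.comp_def, smul_smul] using h
    exact h1.unique h2

theorem exists_isUnitarySpread_mem_schauderSpectrum [CompleteSpace H] {A : H →L[ℂ] H}
    (hS : IsSchauderOperator A) {f : ℤ ⊕ ℕ → H} (hf : Orthonormal ℂ f)
    (hfA : Pairwise fun i j => ⟪f i, A (f j)⟫_ℂ = 0)
    (hAA : Pairwise fun i j => ⟪A (f i), A (f j)⟫_ℂ = 0) :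
    ∃ U : H →L[ℂ] H, IsUnitarySpread U ∧ ∀ μ : ℂ, μ ≠ 0 →
      (Summable fun n : ℕ => ∏ k ∈ Finset.range (n + 1), (‖A (f (.inl k))‖ / ‖μ‖) ^ 2) →
      (Summable fun n : ℕ =>
        ∏ k ∈ Finset.range (n + 1), (‖μ‖ / ‖A (f (.inl (Int.negSucc k)))‖) ^ 2) →
      μ ∈ schauderSpectrum (U ∘L A) := by
  have h0 : ∀ k : ℤ, A (f (.inl k)) ≠ 0 := fun k hk =>
    hf.ne_zero (.inl k) (hS.eq_zero_of_apply_eq_zero hk)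
  have : TopologicalSpace.SeparableSpace H :=
    let ⟨e, _⟩ := hS
    separableSpace_of_hilbertBasis e
  obtain ⟨U, hU, hUA⟩ := exists_isUnitarySpread_apply_eq_smul A hf hfA hAA h0
  exact ⟨U, hU, fun μ hμ hpos hneg => mem_schauderSpectrum_of_bilateral_shift
    (hf.comp _ Sum.inl_injective) (a := fun k => ‖A (f (.inl k))‖)
    (fun k => norm_ne_zero_iff.2 (h0 k)) hUA hμ hpos hneg⟩

/-! ### Two points of the essential spectrum -/

theorem summable_prod_sq_of_tendsto {a : ℕ → ℝ} {c : ℝ} (ha : ∀ n, a n ≠ 0)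
    (hlim : Tendsto a atTop (𝓝 c)) (hc : |c| < 1) :
    Summable fun n : ℕ => ∏ k ∈ Finset.range (n + 1), a k ^ 2 := by
  refine summable_of_ratio_test_tendsto_lt_one (l := c ^ 2) ((sq_lt_one_iff_abs_lt_one c).2 hc)
    (Eventually.of_forall fun n => Finset.prod_ne_zero_iff.2 fun k _ => pow_ne_zero 2 (ha k)) ?_
  refine (((tendsto_add_atTop_iff_nat 1).2 hlim).pow 2).congr fun n => ?_
  have hne : ∏ k ∈ Finset.range (n + 1), a k ^ 2 ≠ 0 :=
    Finset.prod_ne_zero_iff.2 fun k _ => pow_ne_zero 2 (ha k)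
  rw [Finset.prod_range_succ _ (n + 1), norm_mul, mul_div_cancel_left₀ _ (norm_ne_zero_iff.2 hne),
    Real.norm_eq_abs, abs_of_nonneg (sq_nonneg _)]

/-- The annulus is empty if `l₂ ≤ l₁`; it is the strict inequality `l₁ < ‖μ‖ < l₂` which makes the
coefficients of the eigenvector decay geometrically in both directions. -/
theorem exists_isUnitarySpread_openAnnulus [CompleteSpace H] {A : H →L[ℂ] H}
    (hA : IsSelfAdjoint A) (hS : IsSchauderOperator A) {l₁ l₂ : ℝ} (h₁ : 0 < l₁)
    (hl₁ : (l₁ : ℂ) ∈ essentialSpectrum A) (hl₂ : (l₂ : ℂ) ∈ essentialSpectrum A) :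
    ∃ U : H →L[ℂ] H, IsUnitarySpread U ∧ openAnnulus l₁ l₂ ⊆ schauderSpectrum (U ∘L A) := by
  have hsym : ∀ x y, ⟪A x, y⟫_ℂ = ⟪x, A y⟫_ℂ := hA.isSymmetric
  -- the target of `‖A (f i)‖`; the vectors with index in `ℕ` only fill up the blocks, and any point
  -- of the essential spectrum serves for them
  let l : ℤ ⊕ ℕ → ℝ := Sum.elim (fun k => if 0 ≤ k then l₁ else l₂) fun _ => l₁
  have hl : ∀ i, (l i : ℂ) ∈ essentialSpectrum A := by
    rintro (k | n)
    · by_cases hk : 0 ≤ k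
      · simpa [l, hk] using hl₁
      · simpa [l, hk] using hl₂
    · exact hl₁
  let z : ℕ ≃ ℤ ⊕ ℕ := (Denumerable.eqv (ℤ ⊕ ℕ)).symm
  obtain ⟨φ, hφ, hφ'⟩ := exists_seq_of_forall_finset
    (Q := fun n x => ‖x‖ = 1 ∧ |‖A x‖ - ‖l (z n)‖| < 1 / ((n : ℝ) + 1))
    (fun n s => by
      obtain ⟨x, h1, h2, h3⟩ := exists_unit_approx_eigenvector hA (hl (z n)) s
        (ε := 1 / ((n : ℝ) + 1)) (by positivity)
      exact ⟨x, ⟨h1, h2⟩, h3⟩) A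
  have horth : ∀ m n, m ≠ n → ⟪φ m, φ n⟫_ℂ = 0 ∧ ⟪φ m, A (φ n)⟫_ℂ = 0 ∧
      ⟪A (φ m), A (φ n)⟫_ℂ = 0 := by
    have key : ∀ m n, m < n → ⟪φ m, φ n⟫_ℂ = 0 ∧ ⟪φ m, A (φ n)⟫_ℂ = 0 ∧
        ⟪A (φ m), A (φ n)⟫_ℂ = 0 := by
      intro m n hmn
      obtain ⟨h1, h2, h3⟩ := hφ' m n hmn
      exact ⟨h1, by rw [← hsym, h2], by rw [← hsym, h3]⟩
    intro m n hmn
    rcases hmn.lt_or_gt with h | h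
    · exact key m n h
    · obtain ⟨h1, h2, h3⟩ := key n m h
      refine ⟨inner_eq_zero_symm.1 h1, ?_, inner_eq_zero_symm.1 h3⟩
      rw [← hsym]
      exact inner_eq_zero_symm.1 h2
  let f : ℤ ⊕ ℕ → H := fun i => φ (z.symm i)
  have hf : Orthonormal ℂ f :=
    ⟨fun i => (hφ _).1, fun i j hij => (horth _ _ (z.symm.injective.ne hij)).1⟩
  obtain ⟨U, hU, hμU⟩ := exists_isUnitarySpread_mem_schauderSpectrum hS hf
    (fun i j hij => (horth _ _ (z.symm.injective.ne hij)).2.1)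
    (fun i j hij => (horth _ _ (z.symm.injective.ne hij)).2.2)
  have hlim : ∀ g : ℕ → ℤ, Function.Injective g → ∀ c : ℝ, (∀ n, l (.inl (g n)) = c) →
      Tendsto (fun n => ‖A (f (.inl (g n)))‖) atTop (𝓝 ‖c‖) := by
    intro g hg c hc
    have hinj : Function.Injective fun n => z.symm (.inl (g n)) :=
      z.symm.injective.comp (Sum.inl_injective.comp hg)
    have h := tendsto_one_div_add_atTop_nhds_zero_nat (𝕜 := ℝ) |>.comp
      (Nat.cofinite_eq_atTop ▸ hinj.tendsto_cofinite)
    refine tendsto_iff_dist_tendsto_zero.2 (squeeze_zero (fun _ => dist_nonneg) (fun n => ?_) h)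
    have h2 := (hφ (z.symm (.inl (g n)))).2
    rw [Equiv.apply_symm_apply, hc] at h2
    exact h2.le
  refine ⟨U, hU, fun μ hμ => ?_⟩
  obtain ⟨hμ1, hμ2⟩ := hμ
  have hμ0 : 0 < ‖μ‖ := h₁.trans hμ1
  have hA0 : ∀ i, ‖A (f i)‖ ≠ 0 := fun i hi =>
    hf.ne_zero i (hS.eq_zero_of_apply_eq_zero (norm_eq_zero.1 hi))
  refine hμU μ (norm_pos_iff.1 hμ0) ?_ ?_
  · refine summable_prod_sq_of_tendsto (c := ‖l₁‖ / ‖μ‖) (fun n => div_ne_zero (hA0 _) hμ0.ne')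
      ((hlim (fun n => (n : ℤ)) Nat.cast_injective l₁ fun n => ?_).div_const _) ?_
    · simp [l]
    · rw [Real.norm_of_nonneg h₁.le, abs_of_nonneg (by positivity)]
      exact (div_lt_one hμ0).2 hμ1
  · have h2 : 0 < l₂ := hμ0.trans hμ2
    refine summable_prod_sq_of_tendsto (c := ‖μ‖ / ‖l₂‖) (fun n => div_ne_zero hμ0.ne' (hA0 _))
      (tendsto_const_nhds.div (hlim Int.negSucc (fun _ _ => Int.negSucc.inj) l₂ fun n => ?_)
        (by simpa using h2.ne')) ?_
    · simp [l]
    · rw [Real.norm_of_nonneg h2.le, abs_of_nonneg (by positivity)]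
      exact (div_lt_one h2).2 hμ2

/-! ### A single point of the essential spectrum -/

theorem one_sub_sum_le_prod {ι : Type*} (s : Finset ι) {u x : ι → ℝ} (hu : ∀ i, 0 ≤ u i)
    (hx : ∀ i, 0 ≤ x i) (h : ∀ i, 1 - x i ≤ u i) : 1 - ∑ i ∈ s, x i ≤ ∏ i ∈ s, u i := by
  classical
  induction s using Finset.induction_on with
  | empty => simp
  | insert a s ha ih =>
    rw [Finset.sum_insert ha, Finset.prod_insert ha]
    have hP : 0 ≤ ∏ i ∈ s, u i := Finset.prod_nonneg fun i _ => hu i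
    have hS : 0 ≤ ∑ i ∈ s, x i := Finset.sum_nonneg fun i _ => hx i
    rcases le_total 1 (x a + ∑ i ∈ s, x i) with h1 | h1
    · exact (sub_nonpos.2 h1).trans (mul_nonneg (hu a) hP)
    · calc 1 - (x a + ∑ i ∈ s, x i) ≤ (1 - x a) * (1 - ∑ i ∈ s, x i) := by
            nlinarith [mul_nonneg (hx a) hS]
        _ ≤ u a * ∏ i ∈ s, u i := mul_le_mul (h a) ih (by linarith [hx a]) (hu a)

/-- A sparse subsequence `u ∘ d` can be removed without losing summability of the partial products:
if `u (d i)` tends to `1` fast enough, the removed factors have products bounded below. -/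
theorem exists_strictMono_summable_prod {u : ℕ → ℝ} (hu : ∀ k, 0 ≤ u k)
    (hlim : Tendsto u atTop (𝓝 1))
    (hsum : Summable fun n : ℕ => ∏ k ∈ Finset.range (n + 1), u k) :
    ∃ s d : ℕ → ℕ, StrictMono s ∧ StrictMono d ∧ (∀ i j, s i ≠ d j) ∧
      Summable fun n : ℕ => ∏ k ∈ Finset.range (n + 1), u (s k) := by
  classical
  have hev : ∀ n : ℕ, ∀ᶠ k in atTop, 1 - (1 / 2 : ℝ) ^ n * (1 / 4) ≤ u k := fun n =>
    (hlim.eventually (lt_mem_nhds (by simp : 1 - (1 / 2 : ℝ) ^ n * (1 / 4) < 1))).mono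
      fun _ h => h.le
  obtain ⟨φ, hφ, hφu⟩ := extraction_forall_of_eventually hev
  -- only every other term of `φ` is dropped, so that infinitely many indices remain
  let d : ℕ → ℕ := fun i => φ (2 * i)
  have hd : StrictMono d := fun i j hij => hφ (by omega)
  have hdu : ∀ i, 1 - (1 / 2 : ℝ) ^ i * (1 / 4) ≤ u (d i) := by
    intro i
    refine le_trans ?_ (hφu (2 * i))
    have : (1 / 2 : ℝ) ^ (2 * i) ≤ (1 / 2) ^ i :=
      pow_le_pow_of_le_one (by norm_num) (by norm_num) (by omega)
    linarith
  have hinf : {k | k ∉ Set.range d}.Infinite := by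
    refine (Set.infinite_range_of_injective (f := fun i => φ (2 * i + 1)) fun i j hij => ?_).mono ?_
    · have := hφ.injective hij
      omega
    · rintro _ ⟨i, rfl⟩ ⟨j, hj⟩
      have := hφ.injective hj
      omega
  let s : ℕ → ℕ := Nat.nth fun k => k ∉ Set.range d
  have hs : StrictMono s := Nat.nth_strictMono hinf
  have hsrange : Set.range s = {k | k ∉ Set.range d} := Nat.range_nth_of_infinite hinf
  have hsd : ∀ i, s i ∉ Set.range d := fun i => Nat.nth_mem_of_infinite hinf i
  refine ⟨s, d, hs, hd, fun i j h => hsd i ⟨j, h.symm⟩, ?_⟩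
  have hdrop : ∀ m, (1 / 2 : ℝ) ≤ ∏ k ∈ Finset.range m with k ∈ Set.range d, u k := by
    intro m
    have himage : (Finset.range m).filter (· ∈ Set.range d) =
        ((Finset.range m).filter (d · < m)).image d := by
      ext k
      simp only [Finset.mem_filter, Finset.mem_range, Finset.mem_image]
      constructor
      · rintro ⟨hk, i, rfl⟩
        exact ⟨i, ⟨(hd.le_apply).trans_lt hk, hk⟩, rfl⟩
      · rintro ⟨i, ⟨_, hi⟩, rfl⟩
        exact ⟨hi, i, rfl⟩
    rw [himage, Finset.prod_image hd.injective.injOn]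
    refine le_trans ?_ (one_sub_sum_le_prod _ (fun i => hu (d i)) (fun i => by positivity) hdu)
    have h := sum_le_hasSum ((Finset.range m).filter (d · < m)) (fun i _ => by positivity)
      (hasSum_geometric_two.mul_right (1 / 4 : ℝ))
    linarith
  have hkeep : ∀ n, ∏ k ∈ Finset.range (n + 1), u (s k) =
      ∏ k ∈ Finset.range (s n + 1) with k ∉ Set.range d, u k := by
    intro n
    have himage : (Finset.range (s n + 1)).filter (· ∉ Set.range d) =
        (Finset.range (n + 1)).image s := by
      ext k
      simp only [Finset.mem_filter, Finset.mem_range, Finset.mem_image, Nat.lt_succ_iff]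
      constructor
      · rintro ⟨hk, hkd⟩
        obtain ⟨i, rfl⟩ : k ∈ Set.range s := hsrange ▸ hkd
        exact ⟨i, hs.le_iff_le.1 hk, rfl⟩
      · rintro ⟨i, hi, rfl⟩
        exact ⟨hs.monotone hi, hsd i⟩
    rw [himage, Finset.prod_image hs.injective.injOn]
  refine Summable.of_nonneg_of_le (fun n => Finset.prod_nonneg fun k _ => hu _) (fun n => ?_)
    ((hsum.comp_injective hs.injective).mul_left 2)
  have h0 : 0 ≤ ∏ k ∈ Finset.range (n + 1), u (s k) := Finset.prod_nonneg fun k _ => hu _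
  rw [Function.comp_apply, ← Finset.prod_filter_mul_prod_filter_not (Finset.range (s n + 1))
    (· ∈ Set.range d), ← hkeep]
  nlinarith [hdrop (s n + 1)]

theorem exists_isUnitarySpread_sphere [CompleteSpace H] {A : H →L[ℂ] H}
    (hA : IsSelfAdjoint A) (hS : IsSchauderOperator A) {l : ℝ} {t r : ℕ → ℝ} (hl : 0 < l)
    (hess : essentialSpectrum A = {(l : ℂ)}) (htA : ∀ k, (t k : ℂ) ∈ spectrum ℂ A)
    (hrA : ∀ k, (r k : ℂ) ∈ spectrum ℂ A) (ht : StrictMono t) (hr : StrictAnti r)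
    (htl : Tendsto t atTop (𝓝 l)) (hrl : Tendsto r atTop (𝓝 l))
    (hts : Summable fun n : ℕ => ∏ k ∈ Finset.range (n + 1), (t k / l) ^ 2)
    (hrs : Summable fun n : ℕ => ∏ k ∈ Finset.range (n + 1), (l / r k) ^ 2) :
    ∃ U : H →L[ℂ] H, IsUnitarySpread U ∧
      {μ : ℂ | ‖μ‖ = l} ⊆ schauderSpectrum (U ∘L A) := by
  have hsym : ∀ x y, ⟪A x, y⟫_ℂ = ⟪x, A y⟫_ℂ := hA.isSymmetric
  have htlt : ∀ k, t k < l := fun k =>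
    (ht (Nat.lt_succ_self k)).trans_le (ht.monotone.ge_of_tendsto htl _)
  have hrlt : ∀ k, l < r k := fun k =>
    (hr.antitone.le_of_tendsto hrl _).trans_lt (hr (Nat.lt_succ_self k))
  obtain ⟨s, d, hs, hd, hsd, hsum⟩ := exists_strictMono_summable_prod
    (u := fun k => (t k / l) ^ 2) (fun k => sq_nonneg _)
    (by simpa [hl.ne'] using (htl.div_const l).pow 2) hts
  -- the eigenvalues: `t ∘ s` to the right, `r` to the left, and `t ∘ d` for the remaining levels
  let ev : ℤ ⊕ ℕ → ℝ := fun i => match i with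
    | .inl (Int.ofNat n) => t (s n)
    | .inl (Int.negSucc n) => r n
    | .inr n => t (d n)
  have hev : ∀ i, ∃ x, ‖x‖ = 1 ∧ A x = (ev i : ℂ) • x := by
    have hne : ∀ c : ℝ, c ≠ l → (c : ℂ) ∉ essentialSpectrum A := by
      intro c hc
      rw [hess]
      simpa using hc
    rintro ((n | n) | n)
    · exact exists_unit_eigenvector hA (htA _) (hne _ (htlt _).ne)
    · exact exists_unit_eigenvector hA (hrA _) (hne _ (hrlt _).ne')
    · exact exists_unit_eigenvector hA (htA _) (hne _ (htlt _).ne)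
  have hinj : Function.Injective ev := by
    have htr : ∀ m n, t m ≠ r n := fun m n => ((htlt m).trans (hrlt n)).ne
    rintro ((m | m) | m) ((n | n) | n) h
    · rw [hs.injective (ht.injective h)]
    · exact (htr _ _ h).elim
    · exact (hsd _ _ (ht.injective h)).elim
    · exact (htr _ _ h.symm).elim
    · rw [hr.injective h]
    · exact (htr _ _ h.symm).elim
    · exact (hsd _ _ (ht.injective h).symm).elim
    · exact (htr _ _ h).elim
    · rw [hd.injective (ht.injective h)]
  choose f hf1 hfA using hev
  have hf : Orthonormal ℂ f := by
    refine ⟨hf1, fun i j hij => ?_⟩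
    have h := hsym (f i) (f j)
    rw [hfA, hfA, inner_smul_left, inner_smul_right, Complex.conj_ofReal, ← sub_eq_zero,
      ← sub_mul, mul_eq_zero, sub_eq_zero, Complex.ofReal_inj] at h
    exact h.resolve_left (hinj.ne hij)
  obtain ⟨U, hU, hμU⟩ := exists_isUnitarySpread_mem_schauderSpectrum hS hf
    (fun i j hij => by simp [hfA, hf.2 hij])
    (fun i j hij => by simp [hfA, hf.2 hij])
  have hnorm : ∀ i, ‖A (f i)‖ = |ev i| := by
    intro i
    rw [hfA, norm_smul, hf1, mul_one, Complex.norm_real, Real.norm_eq_abs]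
  refine ⟨U, hU, fun μ hμ => ?_⟩
  have hμl : ‖μ‖ = l := hμ
  refine hμU μ (norm_pos_iff.1 (hμl ▸ hl)) ?_ ?_
  · refine hsum.congr fun n => Finset.prod_congr rfl fun k _ => ?_
    rw [hnorm, hμl, div_pow, div_pow, sq_abs]
  · refine hrs.congr fun n => Finset.prod_congr rfl fun k _ => ?_
    rw [hnorm, hμl, div_pow, div_pow, sq_abs]

end SchauderOp

theorem theorem1p1 {H : Type*} [NormedAddCommGroup H] [InnerProductSpace ℂ H] [CompleteSpace H]
    (A : H →L[ℂ] H) (hA : IsSelfAdjoint A) (hS : SchauderOp.IsSchauderOperator A) :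
    -- (i)
    (∀ l₁ l₂ : ℝ, spectrum ℂ A ⊆ (fun t : ℝ => (t : ℂ)) '' Set.Icc l₁ l₂ → 0 < l₁ →
      (l₁ : ℂ) ∈ SchauderOp.essentialSpectrum A → (l₂ : ℂ) ∈ SchauderOp.essentialSpectrum A →
      ∃ U : H →L[ℂ] H, SchauderOp.IsUnitarySpread U ∧
        ∀ R : Set ℂ, SchauderOp.IsRing R → R ⊆ SchauderOp.openAnnulus l₁ l₂ →
          R ⊆ SchauderOp.schauderSpectrum (U ∘L A)) ∧
    -- (ii)
    (∀ l₁ l₂ : ℝ, 0 < l₁ → l₁ < l₂ →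
      (l₁ : ℂ) ∈ SchauderOp.essentialSpectrum A → (l₂ : ℂ) ∈ SchauderOp.essentialSpectrum A →
      ∃ U : H →L[ℂ] H, SchauderOp.IsUnitarySpread U ∧
        ∀ R : Set ℂ, SchauderOp.IsRing R → R ⊆ SchauderOp.openAnnulus l₁ l₂ →
          R ⊆ SchauderOp.schauderSpectrum (U ∘L A)) ∧
    -- (iii)
    (∀ (l₁ : ℝ) (t r : ℕ → ℝ), 0 < l₁ → SchauderOp.essentialSpectrum A = {(l₁ : ℂ)} →
      (∀ k, (t k : ℂ) ∈ spectrum ℂ A) → (∀ k, (r k : ℂ) ∈ spectrum ℂ A) →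
      (∀ k, t k < t (k + 1)) → (∀ k, r (k + 1) < r k) →
      Tendsto t atTop (𝓝 l₁) → Tendsto r atTop (𝓝 l₁) →
      Summable (fun n : ℕ => ∏ k ∈ Finset.range (n + 1), (t k / l₁) ^ 2) →
      Summable (fun n : ℕ => ∏ k ∈ Finset.range (n + 1), (l₁ / r k) ^ 2) →
      ∃ U : H →L[ℂ] H, SchauderOp.IsUnitarySpread U ∧
        {μ : ℂ | ‖μ‖ = l₁} ⊆ SchauderOp.schauderSpectrum (U ∘L A)) := by
  have key : ∀ l₁ l₂ : ℝ, 0 < l₁ → (l₁ : ℂ) ∈ SchauderOp.essentialSpectrum A →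
      (l₂ : ℂ) ∈ SchauderOp.essentialSpectrum A →
      ∃ U : H →L[ℂ] H, SchauderOp.IsUnitarySpread U ∧
        ∀ R : Set ℂ, SchauderOp.IsRing R → R ⊆ SchauderOp.openAnnulus l₁ l₂ →
          R ⊆ SchauderOp.schauderSpectrum (U ∘L A) := fun l₁ l₂ h₁ hl₁ hl₂ =>
    let ⟨U, hU, h⟩ := SchauderOp.exists_isUnitarySpread_openAnnulus hA hS h₁ hl₁ hl₂
    ⟨U, hU, fun _ _ hR => hR.trans h⟩
  exact ⟨fun l₁ l₂ _ h₁ hl₁ hl₂ => key l₁ l₂ h₁ hl₁ hl₂,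
    fun l₁ l₂ h₁ _ hl₁ hl₂ => key l₁ l₂ h₁ hl₁ hl₂,
    fun l t r hl hess htA hrA ht hr htl hrl hts hrs =>
      SchauderOp.exists_isUnitarySpread_sphere hA hS hl hess htA hrA (strictMono_nat_of_lt_succ ht)
        (strictAnti_nat_of_succ_lt hr) htl hrl hts hrs⟩
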